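/- Let $M$ be a finite set of $m\ge 1$ items. A valuation $v:2^M\to\mathbb{R}_{\ge 0}$ is normalized ($v(\emptyset)=0$) and monotone ($v(S)\le v(T)$ for $S\subseteq T$). It is subadditive if $v(S\cup T)\le v(S)+v(T)$ for all $S,T\subseteq M$, and XOS if it is the pointwise maximum of finitely many additive functions $S\mapsto\sum_{e\in S}a_e$ with $a_e\ge 0$. For a price vector $\mathbf q$ write $\mathbf q(S)=\sum_{e\in S}q_e$. For a real number $\psi$ let $$B=\{0\}\cup\{2^{\,j-3\lceil\log_2 m\rceil}\,\psi \;:\; j=0,1,\dots,3\lceil\log_2 m\rceil-1\}=\{0,2^{-3\lceil\log_2 m\rceil}\psi,2^{1-3\lceil\log_2 m\rceil}\psi,\dots,2^{-1}\psi\}$$ be the set of candidate prices. It has at most $3\lceil\log_2 m\rceil+1$ elements. There are a positive function $\alpha_{\mathrm{sub}}(m)=O(\log\log m)$ (as $m\to\infty$) and a constant $\alpha_{\mathrm{XOS}}>0$, both independent of everything else, such that the following holds for every $m\ge1$, every such $M$, every valuation $v$ on $M$ that is subadditive (respectively XOS), every $\psi$ and every $U\subseteq M$ with $v(U)\le\psi$.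 There exist a probability distribution $\lambda$ over the subsets of $U$ and prices $\mathbf q\in B^{U}$ such that, for every $T\subseteq U$, $$\sum_{S\subseteq U}\lambda_S\bigl(v(S\setminus T)-\mathbf q(S)\bigr)\;\ge\;\frac1\alpha\,v(U)-2\,\mathbf q(T)-\frac{\psi}{m^2},$$ with $\alpha=\alpha_{\mathrm{sub}}(m)$ in the subadditive case (respectively $\alpha=\alpha_{\mathrm{XOS}}$ in the XOS case). -/

import Mathlib

/-- A valuation on the item set `M`: normalized and monotone (hence nonnegative). -/
structure IsItemValuation {M : Type*} (v : Finset M → ℝ) : Prop where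
  normalized : v ∅ = 0
  mono : ∀ S T : Finset M, S ⊆ T → v S ≤ v T

/-- `v(S ∪ T) ≤ v(S) + v(T)` for all sets of items `S`, `T`. -/
def IsSubadditiveValuation {M : Type*} [DecidableEq M] (v : Finset M → ℝ) : Prop :=
  ∀ S T : Finset M, v (S ∪ T) ≤ v S + v T

/-- `v` is XOS: the pointwise maximum of a finite nonempty family of additive functions with
nonnegative item values. (Nonemptiness is forced, as every `v S` is attained.) -/
def IsXOSValuation {M : Type*} (v : Finset M → ℝ) : Prop :=
  ∃ A : Finset (M → ℝ), (∀ a ∈ A, ∀ e, 0 ≤ a e) ∧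
    ∀ S : Finset M, IsGreatest {x : ℝ | ∃ a ∈ A, x = ∑ e ∈ S, a e} (v S)

/-- The candidate prices `{0, 2^(-3L) ψ, 2^(1-3L) ψ, …, 2^(-1) ψ}` with `L = ⌈log₂ m⌉`. -/
noncomputable def candidatePrices (m : ℕ) (ψ : ℝ) : Finset ℝ :=
  insert 0 ((Finset.range (3 * ⌈Real.logb 2 (m : ℝ)⌉₊)).image
    (fun j : ℕ => (2 : ℝ) ^ ((j : ℤ) - 3 * (⌈Real.logb 2 (m : ℝ)⌉₊ : ℤ)) * ψ))

/-- `lam` gives the weights of a probability distribution over the subsets of `U`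
(only its values on subsets of `U` matter). -/
structure IsDistributionOnSubsets {M : Type*} (U : Finset M) (lam : Finset M → ℝ) : Prop where
  nonneg : ∀ S ∈ U.powerset, 0 ≤ lam S
  sum_eq_one : ∑ S ∈ U.powerset, lam S = 1

/-! Call a random set `S` with marginals at most `r` robust if it keeps expected value at least `c`
after deletion of any independent random `T` with marginals at most `r`. Separating hyperplanes turn
robustness into prices `p` for which the Lagrangian term `r * p(U)` pays for the expected price of
`S`; hence `c - p(T)` bounds the expected utility after deleting `T` (`exists_balanced_prices`).

In the subadditive case let `f(r)` be the best expected value under marginals `r`. Since `S ∩ T` has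
marginals at most `r ^ 2`, a near-optimal `S` is robust at any level below `f(r) - f(r ^ 2)`. Along
`r = 2 ^ (-2 ^ i)` these drops telescope to at least `v(U) / 4` within about `log log m` steps, so
one of them is large. In the XOS case, taking `U` with probability `1/2` is already robust.

Rounding the prices down to candidates costs the factor `2` and the term `ψ / m ^ 2`
(`exists_candidatePrices_of_balanced`). -/

/-- Distributions over the subsets of `U` under which every item appears with probability at
most `r`. -/
structure IsDistributionWithMarginals {M : Type*} [DecidableEq M] (U : Finset M) (r : ℝ)
    (lam : Finset M → ℝ) : Prop extends IsDistributionOnSubsets U lam where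
  marginal_le : ∀ e ∈ U, ∑ S ∈ U.powerset, lam S * (if e ∈ S then 1 else 0) ≤ r

theorem IsItemValuation.nonneg {M : Type*} {v : Finset M → ℝ} (hv : IsItemValuation v)
    (S : Finset M) : 0 ≤ v S :=
  hv.normalized ▸ hv.mono ∅ S (Finset.empty_subset S)

/-! ### Random subsets with bounded marginals -/

section Distributions

variable {M : Type*} {U : Finset M}

theorem IsDistributionOnSubsets.sum_mul_le {lam : Finset M → ℝ}
    (h : IsDistributionOnSubsets U lam) {w : Finset M → ℝ} {c : ℝ} (hw : ∀ S ⊆ U, w S ≤ c) :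
    ∑ S ∈ U.powerset, lam S * w S ≤ c := by
  calc ∑ S ∈ U.powerset, lam S * w S ≤ ∑ S ∈ U.powerset, lam S * c :=
        Finset.sum_le_sum fun S hS =>
          mul_le_mul_of_nonneg_left (hw S (Finset.mem_powerset.1 hS)) (h.nonneg S hS)
    _ = c := by rw [← Finset.sum_mul, h.sum_eq_one, one_mul]

theorem IsDistributionOnSubsets.le_sum_mul {lam : Finset M → ℝ}
    (h : IsDistributionOnSubsets U lam) {w : Finset M → ℝ} {c : ℝ} (hw : ∀ S ⊆ U, c ≤ w S) :
    c ≤ ∑ S ∈ U.powerset, lam S * w S := by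
  have := h.sum_mul_le (w := fun S => -w S) (c := -c) fun S hS => neg_le_neg (hw S hS)
  simp only [mul_neg, Finset.sum_neg_distrib] at this
  linarith

variable [DecidableEq M]

/-- Exchange of summation for the expected additive value of a random set. -/
theorem sum_mul_sum_eq_sum_marginal (lam : Finset M → ℝ) (p : M → ℝ) :
    ∑ S ∈ U.powerset, lam S * ∑ e ∈ S, p e =
      ∑ e ∈ U, p e * ∑ S ∈ U.powerset, lam S * (if e ∈ S then 1 else 0) := by
  simp_rw [Finset.mul_sum]
  rw [Finset.sum_comm' (s' := fun e => U.powerset.filter (e ∈ ·)) (t' := U)]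
  · refine Finset.sum_congr rfl fun e _ => ?_
    rw [Finset.sum_filter]
    refine Finset.sum_congr rfl fun S _ => ?_
    split_ifs <;> ring
  · intro S e
    simp only [Finset.mem_powerset, Finset.mem_filter]
    exact ⟨fun h => ⟨h, h.1 h.2⟩, fun h => h.1⟩

theorem IsDistributionWithMarginals.sum_mul_sum_le {lam : Finset M → ℝ} {r : ℝ}
    (h : IsDistributionWithMarginals U r lam) {p : M → ℝ} (hp : ∀ e, 0 ≤ p e) :
    ∑ S ∈ U.powerset, lam S * ∑ e ∈ S, p e ≤ r * ∑ e ∈ U, p e := by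
  rw [sum_mul_sum_eq_sum_marginal, mul_comm, Finset.sum_mul]
  exact Finset.sum_le_sum fun e he => mul_le_mul_of_nonneg_left (h.marginal_le e he) (hp e)

/-- The intersection of two independent random sets. -/
theorem IsDistributionWithMarginals.exists_inter {lam mu : Finset M → ℝ} {r s : ℝ}
    (hlam : IsDistributionWithMarginals U r lam) (hmu : IsDistributionWithMarginals U s mu)
    (hr : 0 ≤ r) :
    ∃ nu, IsDistributionWithMarginals U (r * s) nu ∧ ∀ w : Finset M → ℝ,
      ∑ R ∈ U.powerset, nu R * w R =
        ∑ T ∈ U.powerset, mu T * ∑ S ∈ U.powerset, lam S * w (S ∩ T) := by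
  set nu : Finset M → ℝ := fun R =>
    ∑ T ∈ U.powerset, ∑ S ∈ U.powerset, if S ∩ T = R then mu T * lam S else 0 with hnu
  have key : ∀ w : Finset M → ℝ, ∑ R ∈ U.powerset, nu R * w R =
      ∑ T ∈ U.powerset, mu T * ∑ S ∈ U.powerset, lam S * w (S ∩ T) := by
    intro w
    simp only [hnu, Finset.sum_mul]
    rw [Finset.sum_comm]
    refine Finset.sum_congr rfl fun T _ => ?_
    rw [Finset.sum_comm, Finset.mul_sum]
    refine Finset.sum_congr rfl fun S hS => ?_
    rw [Finset.sum_eq_single (S ∩ T)]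
    · simp [mul_assoc]
    · intro R _ hR
      simp [hR.symm]
    · intro h
      exact absurd (Finset.mem_powerset.2
        (Finset.inter_subset_left.trans (Finset.mem_powerset.1 hS))) h
  refine ⟨nu, ⟨⟨fun R _ => ?_, ?_⟩, fun e he => ?_⟩, key⟩
  · refine Finset.sum_nonneg fun T hT => Finset.sum_nonneg fun S hS => ?_
    split_ifs
    · exact mul_nonneg (hmu.nonneg T hT) (hlam.nonneg S hS)
    · exact le_rfl
  · simpa [hlam.sum_eq_one, hmu.sum_eq_one] using key fun _ => 1
  · rw [key fun R => if e ∈ R then 1 else 0]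
    have : ∀ T, mu T * ∑ S ∈ U.powerset, lam S * (if e ∈ S ∩ T then (1 : ℝ) else 0) =
        (∑ S ∈ U.powerset, lam S * (if e ∈ S then (1 : ℝ) else 0)) *
          (mu T * (if e ∈ T then 1 else 0)) := by
      intro T
      by_cases hT : e ∈ T <;> simp [hT, mul_comm]
    rw [Finset.sum_congr rfl fun T _ => this T, ← Finset.mul_sum]
    refine mul_le_mul (hlam.marginal_le e he) (hmu.marginal_le e he) ?_ hr
    refine Finset.sum_nonneg fun T hT => mul_nonneg (hmu.nonneg T hT) ?_
    split_ifs <;> norm_num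

/-- The distribution that is `U` with probability `r` and `∅` otherwise. -/
theorem exists_isDistributionWithMarginals (U : Finset M) {r : ℝ} (h0 : 0 ≤ r) (h1 : r ≤ 1) :
    ∃ lam, IsDistributionWithMarginals U r lam ∧ ∀ w : Finset M → ℝ,
      ∑ S ∈ U.powerset, lam S * w S = r * w U + (1 - r) * w ∅ := by
  set lam : Finset M → ℝ := fun S => (if S = U then r else 0) + (if S = ∅ then 1 - r else 0)
  have key : ∀ w : Finset M → ℝ,
      ∑ S ∈ U.powerset, lam S * w S = r * w U + (1 - r) * w ∅ := by
    intro w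
    simp [lam, add_mul, Finset.sum_add_distrib, ite_mul]
  refine ⟨lam, ⟨⟨fun S _ => ?_, ?_⟩, fun e he => ?_⟩, key⟩
  · simp only [lam]
    split_ifs <;> linarith
  · simpa using key fun _ => 1
  · rw [key fun S => if e ∈ S then 1 else 0]
    simp [he]

end Distributions

/-! ### Balanced prices from convex separation -/

section Duality

variable {M : Type*} [Fintype M] [DecidableEq M] {U : Finset M}

/-- Lagrange multipliers for the marginal constraints: a lower bound on the expectation of `h`
over all distributions with marginals at most `r` is certified by nonnegative prices. -/
theorem exists_prices_of_forall_marginals {h : Finset M → ℝ} {c r : ℝ} (hr : 0 < r)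
    (H : ∀ mu, IsDistributionWithMarginals U r mu → c ≤ ∑ T ∈ U.powerset, mu T * h T) :
    ∃ p : M → ℝ, (∀ e, 0 ≤ p e) ∧
      ∀ T ⊆ U, c + r * ∑ e ∈ U, p e ≤ h T + ∑ e ∈ T, p e := by
  set F : Finset M → ℝ × (M → ℝ) := fun T => (h T, fun e => if e ∈ T then 1 else 0) with hF
  -- `A` collects the achievable pairs (expected `h`, marginals); `H` says that none of them lies in
  -- the open box `D`.
  set D : Set (ℝ × (M → ℝ)) := {x | x.1 < c ∧ ∀ e, x.2 e < r} with hD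
  set A : Set (ℝ × (M → ℝ)) :=
    {x | ∃ mu, IsDistributionOnSubsets U mu ∧ x = ∑ T ∈ U.powerset, mu T • F T} with hA
  have hDc : Convex ℝ D := by
    intro x hx y hy a b ha hb hab
    have aux : ∀ {s t z : ℝ}, s < z → t < z → a * s + b * t < z := by
      intro s t z hs ht
      exact (convex_Iio z) hs ht ha hb hab
    exact ⟨aux hx.1 hy.1, fun e => aux (hx.2 e) (hy.2 e)⟩
  have hDo : IsOpen D := by
    have : D = {x | x.1 < c} ∩ ⋂ e, {x | x.2 e < r} := by
      ext x
      simp [hD]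
    rw [this]
    refine (isOpen_lt (by fun_prop) (by fun_prop)).inter (isOpen_iInter_of_finite fun e => ?_)
    exact isOpen_lt (by fun_prop) (by fun_prop)
  have hAc : Convex ℝ A := by
    rintro _ ⟨mu, hmu, rfl⟩ _ ⟨nu, hnu, rfl⟩ a b ha hb hab
    refine ⟨fun T => a * mu T + b * nu T, ⟨fun T hT => ?_, ?_⟩, ?_⟩
    · exact add_nonneg (mul_nonneg ha (hmu.nonneg T hT)) (mul_nonneg hb (hnu.nonneg T hT))
    · rw [Finset.sum_add_distrib, ← Finset.mul_sum, ← Finset.mul_sum, hmu.sum_eq_one,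
        hnu.sum_eq_one]
      linarith
    · simp only [Finset.smul_sum, add_smul, Finset.sum_add_distrib, mul_smul]
  have hdisj : Disjoint D A := by
    rw [Set.disjoint_left]
    rintro _ hx ⟨mu, hmu, rfl⟩
    refine absurd hx.1 (not_lt.2 ?_)
    have h1 : (∑ T ∈ U.powerset, mu T • F T).1 = ∑ T ∈ U.powerset, mu T * h T := by
      simp [Prod.fst_sum, hF]
    rw [h1]
    refine H mu ⟨hmu, fun e _ => ?_⟩
    have h2 := (hx.2 e).le
    simpa [Prod.snd_sum, hF] using h2
  obtain ⟨f, u, hfD, hfA⟩ := geometric_hahn_banach_open hDc hDo hAc hdisj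
  set a : ℝ := f (1, 0) with ha
  set p : M → ℝ := fun e => f (0, Pi.single e 1) with hp
  have hf : ∀ x y, f (x, y) = a * x + ∑ e, p e * y e := by
    intro x y
    have e1 : ((x, y) : ℝ × (M → ℝ)) =
        x • ((1 : ℝ), (0 : M → ℝ)) + ∑ e, y e • ((0 : ℝ), (Pi.single e 1 : M → ℝ)) := by
      refine Prod.ext ?_ ?_
      · simp [Prod.fst_sum]
      · funext i
        simp [Prod.snd_sum, Finset.sum_apply, Pi.single_apply]
    rw [e1, map_add, map_smul, map_sum]
    simp only [map_smul, smul_eq_mul, ha, hp, mul_comm]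
  have hfF : ∀ T ⊆ U, u ≤ a * h T + ∑ e ∈ T, p e := by
    intro T hT
    have := hfA (F T) ⟨fun S => if S = T then 1 else 0, ⟨fun S _ => by positivity, by simp [hT]⟩,
      by simp [hT, ite_smul]⟩
    simpa [hF, hf] using this
  -- a linear function bounded above on a ray has nonpositive slope
  have slope : ∀ {s t z : ℝ}, (∀ n : ℝ, 0 ≤ n → t - s * n < z) → 0 ≤ s := by
    intro s t z hz
    by_contra! hs
    have h0 := hz 0 le_rfl
    have h1 := hz ((z - t) / (-s)) (div_nonneg (by linarith) (by linarith))
    have h2 : s * ((z - t) / (-s)) = -(z - t) := by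
      rw [div_neg, mul_neg, mul_div_cancel₀ _ hs.ne]
    linarith
  have hbase : ∀ ε : ℝ, 0 < ε → ∀ n : ℝ, 0 ≤ n → ∀ y : M → ℝ, (∀ e, 0 ≤ y e) →
      a * (c - ε - n) + ∑ e, p e * (r - ε - y e) < u := by
    intro ε hε n hn y hy
    rw [← hf]
    exact hfD _ ⟨by dsimp only; linarith, fun e => by dsimp only; linarith [hy e]⟩
  have ha0 : 0 ≤ a := by
    refine slope (t := a * (c - 1) + ∑ e, p e * (r - 1 - 0)) (z := u) fun n hn => ?_
    have := hbase 1 one_pos n hn (fun _ => 0) fun _ => le_rfl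
    linarith
  have hp0 : ∀ e, 0 ≤ p e := by
    intro i
    refine slope (t := a * (c - 1 - 0) + ∑ e, p e * (r - 1)) (z := u) fun n hn => ?_
    have := hbase 1 one_pos 0 le_rfl (Pi.single i n) fun e => by
      by_cases h : e = i
      · subst h
        simpa using hn
      · simp [h]
    simp only [mul_sub, Finset.sum_sub_distrib, Pi.single_apply, mul_ite, mul_zero,
      Finset.sum_ite_eq', Finset.mem_univ, if_true] at this ⊢
    linarith
  have hlim : a * c + r * ∑ e, p e ≤ u := by
    set s := a + ∑ e, p e with hs
    have hs0 : 0 ≤ s := add_nonneg ha0 (Finset.sum_nonneg fun e _ => hp0 e)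
    refine le_of_forall_pos_le_add fun δ hδ => ?_
    have hε : 0 < δ / (s + 1) := by positivity
    have := hbase _ hε 0 le_rfl (fun _ => 0) fun _ => le_rfl
    simp only [sub_zero, mul_sub, Finset.sum_sub_distrib, ← Finset.sum_mul] at this
    have h3 : s * (δ / (s + 1)) ≤ δ := by
      rw [mul_div_assoc', div_le_iff₀ (by positivity)]
      nlinarith
    rw [hs, add_mul] at h3
    linarith [mul_comm r (∑ e, p e)]
  -- Slater's condition: `T = ∅` has marginals `0 < r`, so `a = 0` would force every `p e = 0`, and
  -- a zero functional separates nothing strictly.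
  have ha1 : 0 < a := by
    refine ha0.lt_of_ne fun h0 => ?_
    have h1 := hfF ∅ (Finset.empty_subset U)
    rw [← h0] at hlim h1
    simp only [zero_mul, Finset.sum_empty, zero_add] at hlim h1
    have hsum : ∑ e, p e = 0 := by
      refine le_antisymm ?_ (Finset.sum_nonneg fun e _ => hp0 e)
      by_contra! h2
      nlinarith
    have hpz : ∀ e, p e = 0 := fun e =>
      (Finset.sum_eq_zero_iff_of_nonneg fun e _ => hp0 e).1 hsum e (Finset.mem_univ e)
    have h2 := hbase 1 one_pos 0 le_rfl (fun _ => 0) fun _ => le_rfl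
    simp only [← h0, hpz, zero_mul, Finset.sum_const_zero, add_zero] at h2
    linarith
  refine ⟨fun e => p e / a, fun e => div_nonneg (hp0 e) ha0, fun T hT => ?_⟩
  have h1 := hfF T hT
  have h2 : r * ∑ e ∈ U, p e ≤ r * ∑ e, p e :=
    mul_le_mul_of_nonneg_left
      (Finset.sum_le_sum_of_subset_of_nonneg (Finset.subset_univ U) fun e _ _ => hp0 e) hr.le
  have h3 : (a * c + r * ∑ e ∈ U, p e) / a ≤ (a * h T + ∑ e ∈ T, p e) / a :=
    div_le_div_of_nonneg_right (by linarith) ha0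
  rw [← Finset.sum_div, ← Finset.sum_div]
  have e1 : c + r * ((∑ e ∈ U, p e) / a) = (a * c + r * ∑ e ∈ U, p e) / a := by
    field_simp
  have e2 : h T + (∑ e ∈ T, p e) / a = (a * h T + ∑ e ∈ T, p e) / a := by
    field_simp
  rw [e1, e2]
  exact h3

/-- A random set whose value is robust against deleting any independent random set with small
marginals admits balanced prices. -/
theorem exists_balanced_prices {v : Finset M → ℝ} {lam : Finset M → ℝ} {c r : ℝ} (hr : 0 < r)
    (hlam : IsDistributionWithMarginals U r lam)
    (H : ∀ mu, IsDistributionWithMarginals U r mu →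
      c ≤ ∑ T ∈ U.powerset, mu T * ∑ S ∈ U.powerset, lam S * v (S \ T)) :
    ∃ p : M → ℝ, (∀ e, 0 ≤ p e) ∧ ∀ T ⊆ U,
      c - ∑ e ∈ T, p e ≤ ∑ S ∈ U.powerset, lam S * (v (S \ T) - ∑ e ∈ S, p e) := by
  obtain ⟨p, hp, h⟩ := exists_prices_of_forall_marginals hr H
  refine ⟨p, hp, fun T hT => ?_⟩
  have h1 := h T hT
  -- The same `r` bounds the marginals of `lam`, so the expected price is absorbed by the term `r *
  -- ∑ p` in `h1`.
  have h2 := hlam.sum_mul_sum_le hp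
  simp only [mul_sub, Finset.sum_sub_distrib]
  linarith

end Duality

/-! ### Rounding to candidate prices -/

section Rounding

theorem card_candidatePrices_le (m : ℕ) (ψ : ℝ) :
    (candidatePrices m ψ).card ≤ 3 * ⌈Real.logb 2 (m : ℝ)⌉₊ + 1 := by
  refine (Finset.card_insert_le _ _).trans (Nat.add_le_add_right ?_ 1)
  exact Finset.card_image_le.trans (Finset.card_range _).le

theorem exists_between_powers {x : ℝ} (n : ℕ) {y : ℝ} (h0 : y ≤ x) (hn : x < 2 ^ n * y) :
    ∃ j < n, 2 ^ j * y ≤ x ∧ x < 2 * (2 ^ j * y) := by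
  induction n with
  | zero => simp at hn; linarith
  | succ n ih =>
    by_cases h : x < 2 ^ n * y
    · obtain ⟨j, hj, hj'⟩ := ih h
      exact ⟨j, by omega, hj'⟩
    · exact ⟨n, by omega, not_lt.1 h, by rw [pow_succ] at hn; linarith⟩

/-- Round down to a power-of-two multiple of `ψ`. Below the grid, `0` errs by at most `ψ / m ^ 3`;
from `ψ` upwards, the top candidate `ψ / 2` is used. -/
theorem exists_candidatePrice {m : ℕ} (hm : 2 ≤ m) {ψ x : ℝ} (hψ : 0 < ψ) (hx : 0 ≤ x) :
    ∃ q ∈ candidatePrices m ψ, 0 ≤ q ∧ q ≤ x ∧ (x ≤ 2 * q + ψ / (m : ℝ) ^ 3 ∨ ψ ≤ 2 * q) := by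
  set L := ⌈Real.logb 2 (m : ℝ)⌉₊ with hL
  have hm' : (2 : ℝ) ≤ m := by exact_mod_cast hm
  have hlog : 0 < Real.logb 2 (m : ℝ) := Real.logb_pos (by norm_num) (by linarith)
  have hL1 : 1 ≤ L := Nat.one_le_ceil_iff.2 hlog
  have hmL : (m : ℝ) ≤ 2 ^ L := by
    have := Nat.le_ceil (Real.logb 2 (m : ℝ))
    rwa [Real.logb_le_iff_le_rpow (by norm_num) (by linarith), Real.rpow_natCast] at this
  set y : ℝ := ψ / 2 ^ (3 * L) with hy
  have hy0 : 0 < y := by positivity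
  have hyψ : 2 ^ (3 * L) * y = ψ := by
    rw [hy]; field_simp
  have hmem : ∀ j < 3 * L, 2 ^ j * y ∈ candidatePrices m ψ := by
    intro j hj
    refine Finset.mem_insert_of_mem (Finset.mem_image.2 ⟨j, Finset.mem_range.2 hj, ?_⟩)
    rw [← hL, zpow_sub₀ two_ne_zero, hy]
    have : (2 : ℝ) ^ (3 * (L : ℤ)) = 2 ^ (3 * L) := by exact_mod_cast zpow_natCast (2 : ℝ) (3 * L)
    rw [this, zpow_natCast]
    ring
  have hy3 : y ≤ ψ / (m : ℝ) ^ 3 := by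
    refine div_le_div_of_nonneg_left hψ.le (by positivity) ?_
    rw [mul_comm, pow_mul]
    exact pow_le_pow_left₀ (by linarith) hmL 3
  have h3 : 0 ≤ ψ / (m : ℝ) ^ 3 := by positivity
  rcases lt_or_ge x y with h | h
  · exact ⟨0, Finset.mem_insert_self _ _, le_rfl, hx, Or.inl (by linarith)⟩
  rcases lt_or_ge x ψ with h' | h'
  · obtain ⟨j, hj, hj1, hj2⟩ := exists_between_powers (3 * L) h (by rwa [hyψ])
    exact ⟨2 ^ j * y, hmem j hj, by positivity, hj1, Or.inl (by linarith)⟩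
  · have e : 2 * (2 ^ (3 * L - 1) * y) = ψ := by
      rw [← mul_assoc, ← pow_succ', Nat.sub_add_cancel (by omega), hyψ]
    exact ⟨2 ^ (3 * L - 1) * y, hmem _ (by omega), by positivity, by linarith, Or.inr e.ge⟩

variable {M : Type*} [Fintype M] [DecidableEq M] {U : Finset M}

/-- Balanced nonnegative prices can be rounded to candidate prices. -/
theorem exists_candidatePrices_of_balanced {m : ℕ} (hm : Fintype.card M = m) (hm1 : 1 ≤ m)
    {v : Finset M → ℝ} (hv : IsItemValuation v) {ψ β : ℝ} (hβ1 : β ≤ 1)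
    (hψ : v U ≤ ψ)
    (H : 0 < v U → ∃ (lam : Finset M → ℝ) (p : M → ℝ),
      IsDistributionOnSubsets U lam ∧ (∀ e, 0 ≤ p e) ∧ ∀ T ⊆ U,
        β * v U - ∑ e ∈ T, p e ≤ ∑ S ∈ U.powerset, lam S * (v (S \ T) - ∑ e ∈ S, p e)) :
    ∃ (lam : Finset M → ℝ) (q : M → ℝ), IsDistributionOnSubsets U lam ∧
      (∀ e ∈ U, q e ∈ candidatePrices m ψ) ∧ ∀ T ⊆ U,
        β * v U - 2 * (∑ e ∈ T, q e) - ψ / (m : ℝ) ^ 2 ≤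
          ∑ S ∈ U.powerset, lam S * (v (S \ T) - ∑ e ∈ S, q e) := by
  have hU0 := hv.nonneg U
  have hβU : β * v U ≤ v U := mul_le_of_le_one_left hU0 hβ1
  -- Here the empty set at zero prices suffices; this also disposes of `v U = 0` and `m = 1`.
  by_cases htriv : β * v U ≤ ψ / (m : ℝ) ^ 2
  · obtain ⟨lam, hlam, -⟩ := exists_isDistributionWithMarginals U le_rfl zero_le_one
    refine ⟨lam, fun _ => 0, hlam.toIsDistributionOnSubsets,
      fun e _ => Finset.mem_insert_self _ _, fun T _ => ?_⟩
    refine le_trans (b := 0) (by simpa using htriv)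
      (hlam.le_sum_mul fun S _ => by simpa using hv.nonneg _)
  have hpos : 0 < v U := by
    refine hU0.lt_of_ne fun h => htriv ?_
    rw [← h, mul_zero]
    exact div_nonneg (hU0.trans hψ) (by positivity)
  have hm2 : 2 ≤ m := by
    by_contra! h
    obtain rfl : m = 1 := by omega
    refine htriv ?_
    simp
    linarith
  have hm0 : (0 : ℝ) < m := by exact_mod_cast hm1
  have hψ0 : 0 < ψ := hpos.trans_le hψ
  obtain ⟨lam, p, hlam, hp, h⟩ := H hpos
  choose q hqB hq0 hqp hq using fun e => exists_candidatePrice hm2 hψ0 (hp e)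
  refine ⟨lam, q, hlam, fun e _ => hqB e, fun T hT => ?_⟩
  have hsmall : ∀ T : Finset M, (∀ e ∈ T, ¬ ψ ≤ 2 * q e) →
      ∑ e ∈ T, p e ≤ 2 * ∑ e ∈ T, q e + ψ / (m : ℝ) ^ 2 := by
    intro T hT
    calc ∑ e ∈ T, p e ≤ ∑ e ∈ T, (2 * q e + ψ / (m : ℝ) ^ 3) :=
          Finset.sum_le_sum fun e he => (hq e).resolve_right (hT e he)
      _ = 2 * ∑ e ∈ T, q e + T.card * (ψ / (m : ℝ) ^ 3) := by
          rw [Finset.sum_add_distrib, ← Finset.mul_sum, Finset.sum_const, nsmul_eq_mul]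
      _ ≤ 2 * ∑ e ∈ T, q e + m * (ψ / (m : ℝ) ^ 3) := by
          gcongr
          rw [← hm]
          exact Finset.card_le_univ T
      _ = 2 * ∑ e ∈ T, q e + ψ / (m : ℝ) ^ 2 := by
          congr 1
          field_simp
  have hqS : ∀ S : Finset M, ∑ e ∈ S, q e ≤ ∑ e ∈ S, p e :=
    fun S => Finset.sum_le_sum fun e _ => hqp e
  by_cases hbig : ∀ e ∈ T, ¬ ψ ≤ 2 * q e
  · have h1 := h T hT
    have h2 := hsmall T hbig
    refine le_trans (by linarith) (h1.trans (Finset.sum_le_sum fun S hS => ?_))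
    exact mul_le_mul_of_nonneg_left (by linarith [hqS S]) (hlam.nonneg S hS)
  · push Not at hbig
    obtain ⟨i, hi, hiq⟩ := hbig
    -- Deleting only the cheap items `T'` overestimates the value by at most `v U ≤ ψ`, which the
    -- single expensive item `i` repays through `2 * q i ≥ ψ`.
    set T' := T.filter fun e => ¬ ψ ≤ 2 * q e with hT'
    have hTT : T' ⊆ T := Finset.filter_subset _ _
    have h1 := h T' (hTT.trans hT)
    have h2 := hsmall T' fun e he => (Finset.mem_filter.1 he).2
    have h3 : ∑ e ∈ T', q e + q i ≤ ∑ e ∈ T, q e := by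
      have hi' : i ∉ T' := fun h => (Finset.mem_filter.1 h).2 hiq
      rw [add_comm, ← Finset.sum_insert hi']
      exact Finset.sum_le_sum_of_subset_of_nonneg
        (Finset.insert_subset hi hTT) fun e _ _ => hq0 e
    have h4 : ∑ S ∈ U.powerset, lam S * (v (S \ T') - ∑ e ∈ S, p e) ≤
        ∑ S ∈ U.powerset, lam S * ((v (S \ T) - ∑ e ∈ S, q e) + ψ) := by
      refine Finset.sum_le_sum fun S hS => mul_le_mul_of_nonneg_left ?_ (hlam.nonneg S hS)
      have := hv.mono (S \ T') U (Finset.sdiff_subset.trans (Finset.mem_powerset.1 hS))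
      linarith [hqS S, hv.nonneg (S \ T)]
    simp only [mul_add (lam _), Finset.sum_add_distrib, ← Finset.sum_mul, hlam.sum_eq_one] at h4
    linarith

end Rounding

/-! ### Robust random sets for subadditive valuations -/

section Subadditive

variable {M : Type*} [DecidableEq M] {U : Finset M}

/-- The largest expected value of a random subset of `U` with marginals at most `r`. -/
noncomputable def marginalValue (v : Finset M → ℝ) (U : Finset M) (r : ℝ) : ℝ :=
  sSup {x | ∃ lam, IsDistributionWithMarginals U r lam ∧ x = ∑ S ∈ U.powerset, lam S * v S}

theorem le_marginalValue {v : Finset M → ℝ} (hv : IsItemValuation v) {r : ℝ} {lam : Finset M → ℝ}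
    (h : IsDistributionWithMarginals U r lam) :
    ∑ S ∈ U.powerset, lam S * v S ≤ marginalValue v U r := by
  refine le_csSup ⟨v U, ?_⟩ ⟨lam, h, rfl⟩
  rintro _ ⟨mu, hmu, rfl⟩
  exact hmu.sum_mul_le fun S hS => hv.mono S U hS

theorem mul_le_marginalValue {v : Finset M → ℝ} (hv : IsItemValuation v) {r : ℝ} (h0 : 0 ≤ r)
    (h1 : r ≤ 1) : r * v U ≤ marginalValue v U r := by
  obtain ⟨lam, hlam, h⟩ := exists_isDistributionWithMarginals U h0 h1
  have := le_marginalValue hv hlam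
  rwa [h, hv.normalized, mul_zero, add_zero] at this

theorem IsSubadditiveValuation.le_sum {v : Finset M → ℝ} (hv : IsItemValuation v)
    (hs : IsSubadditiveValuation v) (S : Finset M) : v S ≤ ∑ e ∈ S, v {e} := by
  induction S using Finset.induction_on with
  | empty => simp [hv.normalized]
  | insert e S he ih =>
    rw [Finset.sum_insert he, Finset.insert_eq]
    exact (hs _ _).trans (by gcongr)

theorem marginalValue_le {v : Finset M → ℝ} (hv : IsItemValuation v)
    (hs : IsSubadditiveValuation v) {r : ℝ} (h0 : 0 ≤ r) (h1 : r ≤ 1) :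
    marginalValue v U r ≤ r * (U.card * v U) := by
  obtain ⟨lam, hlam, -⟩ := exists_isDistributionWithMarginals U h0 h1
  refine csSup_le ⟨_, lam, hlam, rfl⟩ ?_
  rintro _ ⟨mu, hmu, rfl⟩
  calc ∑ S ∈ U.powerset, mu S * v S ≤ ∑ S ∈ U.powerset, mu S * ∑ e ∈ S, v {e} :=
        Finset.sum_le_sum fun S hS => mul_le_mul_of_nonneg_left (hs.le_sum hv S) (hmu.nonneg S hS)
    _ ≤ r * ∑ e ∈ U, v {e} := hmu.sum_mul_sum_le fun e => hv.nonneg _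
    _ ≤ r * (U.card * v U) := by
        refine mul_le_mul_of_nonneg_left ?_ h0
        rw [← nsmul_eq_mul]
        exact Finset.sum_le_card_nsmul _ _ _ fun e he =>
          hv.mono _ _ (Finset.singleton_subset_iff.2 he)

/-- Subadditivity gives `v S ≤ v (S \ T) + v (S ∩ T)`, and independence makes `S ∩ T` a competitor
at marginal `r ^ 2`. The strict bound on `c` leaves room for a merely near-optimal `lam`. -/
theorem exists_robust_of_lt_marginalValue {v : Finset M → ℝ} (hv : IsItemValuation v)
    (hs : IsSubadditiveValuation v) {r c : ℝ} (h0 : 0 ≤ r) (h1 : r ≤ 1)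
    (hc : c < marginalValue v U r - marginalValue v U (r ^ 2)) :
    ∃ lam, IsDistributionWithMarginals U r lam ∧
      ∀ mu, IsDistributionWithMarginals U r mu →
        c ≤ ∑ T ∈ U.powerset, mu T * ∑ S ∈ U.powerset, lam S * v (S \ T) := by
  obtain ⟨lam₀, hlam₀, -⟩ := exists_isDistributionWithMarginals U h0 h1
  obtain ⟨_, ⟨lam, hlam, rfl⟩, hlt⟩ := exists_lt_of_lt_csSup
    (s := {x | ∃ lam, IsDistributionWithMarginals U r lam ∧ x = ∑ S ∈ U.powerset, lam S * v S})
    ⟨_, lam₀, hlam₀, rfl⟩ (lt_sub_iff_add_lt.1 hc)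
  refine ⟨lam, hlam, fun mu hmu => ?_⟩
  obtain ⟨nu, hnu, h⟩ := hlam.exists_inter hmu h0
  rw [← sq] at hnu
  have h2 := le_marginalValue hv hnu
  rw [h] at h2
  have h3 : ∑ S ∈ U.powerset, lam S * v S ≤ ∑ T ∈ U.powerset, mu T *
      (∑ S ∈ U.powerset, lam S * v (S \ T) + ∑ S ∈ U.powerset, lam S * v (S ∩ T)) := by
    refine hmu.le_sum_mul fun T _ => ?_
    rw [← Finset.sum_add_distrib]
    refine Finset.sum_le_sum fun S hS => ?_
    rw [← mul_add]
    refine mul_le_mul_of_nonneg_left ?_ (hlam.nonneg S hS)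
    simpa [Finset.sdiff_union_inter] using hs (S \ T) (S ∩ T)
  simp only [mul_add, Finset.sum_add_distrib] at h3
  linarith

/-- Among the marginals `2 ^ (-2 ^ i)`, `i < k`, one has a large drop of the marginal value. -/
theorem exists_lt_marginalValue_sub {v : Finset M → ℝ} (hv : IsItemValuation v)
    (hs : IsSubadditiveValuation v) {k : ℕ} (hk : 1 ≤ k) (hU : 0 < v U)
    (hcard : 4 * (U.card : ℝ) ≤ 2 ^ 2 ^ k) :
    ∃ r : ℝ, 0 < r ∧ r ≤ 1 ∧
      1 / (8 * k) * v U < marginalValue v U r - marginalValue v U (r ^ 2) := by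
  by_contra! hcon
  have hk0 : (0 : ℝ) < k := by exact_mod_cast hk
  set r : ℕ → ℝ := fun i => (1 / 2) ^ 2 ^ i with hr
  have hr0 : ∀ i, 0 < r i := fun i => by positivity
  have hr1 : ∀ i, r i ≤ 1 := fun i => pow_le_one₀ (by norm_num) (by norm_num)
  have hrs : ∀ i, r i ^ 2 = r (i + 1) := fun i => by
    simp only [hr]
    rw [← pow_mul, pow_succ]
  have hsum : ∑ i ∈ Finset.range k, (marginalValue v U (r i) - marginalValue v U (r (i + 1))) ≤
      ∑ _i ∈ Finset.range k, 1 / (8 * k) * v U :=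
    Finset.sum_le_sum fun i _ => hrs i ▸ hcon (r i) (hr0 i) (hr1 i)
  -- The total drop is at least `v U / 2 - v U / 4`; the constant `8` instead of `4` makes the
  -- contradiction strict.
  rw [Finset.sum_range_sub', Finset.sum_const, Finset.card_range, nsmul_eq_mul] at hsum
  have e1 : (k : ℝ) * (1 / (8 * k) * v U) = v U / 8 := by
    field_simp
  have h0 := mul_le_marginalValue (U := U) hv (hr0 0).le (hr1 0)
  have hk' := marginalValue_le (U := U) hv hs (hr0 k).le (hr1 k)
  have h00 : r 0 = 1 / 2 := by simp [hr]
  have h4 : r k * U.card ≤ 1 / 4 := by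
    simp only [hr]
    rw [div_pow, one_pow, div_mul_eq_mul_div, one_mul, div_le_iff₀ (by positivity)]
    linarith
  rw [h00] at h0 hsum
  rw [← mul_assoc] at hk'
  have := mul_le_mul_of_nonneg_right h4 hU.le
  linarith

end Subadditive

/-! ### The `log log m` growth of the number of steps -/

/-- The number of squaring steps needed to get from `1 / 2` down to `1 / (4 m)`. -/
noncomputable def squaringDepth (m : ℕ) : ℕ :=
  ⌈Real.logb 2 (Real.logb 2 (4 * m))⌉₊

theorem two_le_logb_four_mul {m : ℕ} (hm : 1 ≤ m) : 2 ≤ Real.logb 2 (4 * m) := by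
  have hm' : (1 : ℝ) ≤ m := by exact_mod_cast hm
  rw [Real.le_logb_iff_rpow_le (by norm_num) (by linarith)]
  norm_num
  linarith

theorem one_le_squaringDepth {m : ℕ} (hm : 1 ≤ m) : 1 ≤ squaringDepth m :=
  Nat.one_le_ceil_iff.2 (Real.logb_pos (by norm_num) (by linarith [two_le_logb_four_mul hm]))

theorem four_mul_le_two_pow_squaringDepth {m : ℕ} (hm : 1 ≤ m) :
    4 * (m : ℝ) ≤ 2 ^ 2 ^ squaringDepth m := by
  have hm' : (1 : ℝ) ≤ m := by exact_mod_cast hm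
  have h2 := two_le_logb_four_mul hm
  have h1 := Nat.le_ceil (Real.logb 2 (Real.logb 2 (4 * m)))
  rw [Real.logb_le_iff_le_rpow (by norm_num) (by linarith), Real.rpow_natCast] at h1
  rw [Real.logb_le_iff_le_rpow (by norm_num) (by linarith)] at h1
  unfold squaringDepth
  exact_mod_cast h1

open Filter in
theorem squaringDepth_isBigO :
    (fun m : ℕ => 8 * (squaringDepth m : ℝ)) =O[atTop]
      (fun m : ℕ => Real.log (Real.log (m : ℝ))) := by
  have hlim : Tendsto (fun m : ℕ => Real.log (Real.log (m : ℝ))) atTop atTop :=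
    Real.tendsto_log_atTop.comp (Real.tendsto_log_atTop.comp tendsto_natCast_atTop_atTop)
  refine Asymptotics.IsBigO.of_bound (8 * (4 / Real.log 2 + 1)) ?_
  filter_upwards [hlim.eventually_ge_atTop 1, eventually_ge_atTop 4] with m hm hm4
  have hm4' : (4 : ℝ) ≤ m := by exact_mod_cast hm4
  have hl2 : 0 < Real.log 2 := Real.log_pos (by norm_num)
  have hlm : 0 < Real.log m := Real.log_pos (by linarith)
  have hl2m : Real.log 2 ≤ 1 := by linarith [Real.log_two_lt_d9]
  have hceil := Nat.ceil_lt_add_one (a := Real.logb 2 (Real.logb 2 (4 * m)))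
    (Real.logb_nonneg (by norm_num) (by linarith [two_le_logb_four_mul (m := m) (by omega)]))
  have hinner : Real.log (Real.logb 2 (4 * m)) ≤ 4 * Real.log (Real.log m) := by
    have h1 : Real.log (4 * m) ≤ 2 * Real.log m := by
      rw [Real.log_mul (by norm_num) (by linarith)]
      linarith [Real.log_le_log (by norm_num) hm4']
    have h2 : Real.logb 2 (4 * m) ≤ 2 * Real.log m / Real.log 2 := by
      rw [← Real.log_div_log]
      gcongr
    have h3 : 0 < Real.logb 2 (4 * m) := by
      linarith [two_le_logb_four_mul (m := m) (by omega)]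
    have h4 : 2 / Real.log 2 ≤ 4 := by
      rw [div_le_iff₀ hl2]
      linarith [Real.log_two_gt_d9]
    have h5 : Real.logb 2 (4 * m) ≤ 4 * Real.log m := by
      refine h2.trans ?_
      rw [mul_div_right_comm]
      gcongr
    have h6 := Real.log_le_log h3 h5
    rw [Real.log_mul (by norm_num) hlm.ne'] at h6
    have h7 : Real.log 4 ≤ 2 := by
      have : Real.log 4 = 2 * Real.log 2 := by
        rw [show (4 : ℝ) = 2 ^ 2 by norm_num, Real.log_pow]
        norm_num
      linarith
    linarith
  have hdepth : (squaringDepth m : ℝ) ≤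
      4 / Real.log 2 * Real.log (Real.log m) + 1 * Real.log (Real.log m) := by
    refine hceil.le.trans (add_le_add ?_ (by linarith))
    rw [← Real.log_div_log, div_mul_eq_mul_div]
    gcongr
  rw [Real.norm_of_nonneg (by positivity), Real.norm_of_nonneg (by linarith)]
  linarith

/-! ### XOS valuations and the final assembly -/

theorem IsXOSValuation.half_le {M : Type*} [DecidableEq M] {v : Finset M → ℝ}
    (hx : IsXOSValuation v) {U : Finset M} {mu : Finset M → ℝ}
    (hmu : IsDistributionWithMarginals U (1 / 2) mu) :
    1 / 2 * v U ≤ ∑ T ∈ U.powerset, mu T * v (U \ T) := by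
  obtain ⟨A, hA, hmax⟩ := hx
  obtain ⟨a, ha, hav⟩ := (hmax U).1
  have h1 := hmu.sum_mul_sum_le (hA a ha)
  have h2 : ∑ T ∈ U.powerset, mu T * (v U - ∑ e ∈ T, a e) ≤
      ∑ T ∈ U.powerset, mu T * v (U \ T) := by
    -- The additive function attaining `v U` still bounds `v (U \ T)` from below.
    refine Finset.sum_le_sum fun T hT => mul_le_mul_of_nonneg_left ?_ (hmu.nonneg T hT)
    have h3 := (hmax (U \ T)).2 ⟨a, ha, rfl⟩
    have h4 := Finset.sum_sdiff (f := a) (Finset.mem_powerset.1 hT)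
    linarith
  simp only [mul_sub, Finset.sum_sub_distrib, ← Finset.sum_mul, hmu.sum_eq_one] at h2
  rw [← hav] at h1
  linarith

theorem mainTheorem4 :
    -- the number of candidate prices
    (∀ (m : ℕ) (ψ : ℝ), 1 ≤ m →
      (candidatePrices m ψ).card ≤ 3 * ⌈Real.logb 2 (m : ℝ)⌉₊ + 1) ∧
    -- subadditive valuations, with a factor of order `log log m`
    (∃ α : ℕ → ℝ, (∀ m, 1 ≤ m → 0 < α m) ∧
      α =O[Filter.atTop] (fun m : ℕ => Real.log (Real.log (m : ℝ))) ∧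
      ∀ (M : Type*) [Fintype M] [DecidableEq M] (m : ℕ), Fintype.card M = m → 1 ≤ m →
        ∀ v : Finset M → ℝ, IsItemValuation v → IsSubadditiveValuation v →
          ∀ (ψ : ℝ) (U : Finset M), v U ≤ ψ →
            ∃ (lam : Finset M → ℝ) (q : M → ℝ), IsDistributionOnSubsets U lam ∧
              (∀ e ∈ U, q e ∈ candidatePrices m ψ) ∧
              ∀ T ⊆ U,
                (1 / α m) * v U - 2 * (∑ e ∈ T, q e) - ψ / (m : ℝ) ^ 2 ≤
                  ∑ S ∈ U.powerset, lam S * (v (S \ T) - ∑ e ∈ S, q e)) ∧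
    -- XOS valuations, with a constant factor
    (∃ α : ℝ, 0 < α ∧
      ∀ (M : Type*) [Fintype M] [DecidableEq M] (m : ℕ), Fintype.card M = m → 1 ≤ m →
        ∀ v : Finset M → ℝ, IsItemValuation v → IsXOSValuation v →
          ∀ (ψ : ℝ) (U : Finset M), v U ≤ ψ →
            ∃ (lam : Finset M → ℝ) (q : M → ℝ), IsDistributionOnSubsets U lam ∧
              (∀ e ∈ U, q e ∈ candidatePrices m ψ) ∧
              ∀ T ⊆ U,
                (1 / α) * v U - 2 * (∑ e ∈ T, q e) - ψ / (m : ℝ) ^ 2 ≤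
                  ∑ S ∈ U.powerset, lam S * (v (S \ T) - ∑ e ∈ S, q e)) := by
  refine ⟨fun m ψ _ => card_candidatePrices_le m ψ,
    ⟨fun m => 8 * squaringDepth m, fun m hm => ?_, squaringDepth_isBigO, ?_⟩, ⟨4, by norm_num, ?_⟩⟩
  · have := one_le_squaringDepth hm
    positivity
  · intro M _ _ m hm hm1 v hv hs ψ U hψ
    have hk := one_le_squaringDepth hm1
    have hk' : (1 : ℝ) ≤ squaringDepth m := by exact_mod_cast hk
    refine exists_candidatePrices_of_balanced hm hm1 hv ?_ hψ fun hU => ?_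
    · rw [div_le_one (by linarith)]
      linarith
    · have hcard : 4 * (U.card : ℝ) ≤ 2 ^ 2 ^ squaringDepth m := by
        refine le_trans ?_ (four_mul_le_two_pow_squaringDepth hm1)
        have : (U.card : ℝ) ≤ m := by exact_mod_cast hm ▸ Finset.card_le_univ U
        linarith
      obtain ⟨r, hr0, hr1, hr⟩ := exists_lt_marginalValue_sub hv hs hk hU hcard
      obtain ⟨lam, hlam, H⟩ := exists_robust_of_lt_marginalValue hv hs hr0.le hr1 hr
      obtain ⟨p, hp, h⟩ := exists_balanced_prices hr0 hlam H
      exact ⟨lam, p, hlam.toIsDistributionOnSubsets, hp, h⟩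
  · intro M _ _ m hm hm1 v hv hx ψ U hψ
    refine exists_candidatePrices_of_balanced hm hm1 hv (by norm_num) hψ fun _ => ?_
    obtain ⟨lam, hlam, hexp⟩ :=
      exists_isDistributionWithMarginals U (r := 1 / 2) (by norm_num) (by norm_num)
    -- `1 / 4`: one half for drawing `U`, one half for surviving the deletion.
    obtain ⟨p, hp, h⟩ := exists_balanced_prices (v := v) (c := 1 / 4 * v U) (by norm_num) hlam
      fun mu hmu => by
        have e : ∀ T, mu T * ∑ S ∈ U.powerset, lam S * v (S \ T) =
            1 / 2 * (mu T * v (U \ T)) := fun T => by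
          rw [hexp fun S => v (S \ T), Finset.empty_sdiff, hv.normalized]
          ring
        rw [Finset.sum_congr rfl fun T _ => e T, ← Finset.mul_sum]
        linarith [hx.half_le hmu]
    exact ⟨lam, p, hlam.toIsDistributionOnSubsets, hp, h⟩
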